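/- Call $p\in\mathbb{R}[z_1,\dots,z_n]$ *multiaffine* if it has degree at most one in each variable, and *real stable* if $p(z_1,\dots,z_n)\neq 0$ whenever $\operatorname{Im} z_i>0$ for all $i$. A point $\mathbf{a}\in\mathbb{R}^n$ is *above the roots* of $p$ if $p(\mathbf{a}+\mathbf{t})\neq 0$ for every $\mathbf{t}\in\mathbb{R}^n$ with nonnegative coordinates. For multiaffine real stable $p,q\in\mathbb{R}[z_1,\dots,z_n]$ their convolution $p\ast q$ is the polynomial determined by $$(p\ast q)(2z_1,\dots,2z_n)=\left[\frac{\partial^n}{\partial z_1\cdots\partial z_n}(pq)\right](z_1,\dots,z_n).$$ **Proposition.** Let $p,q\in\mathbb{R}[z_1,\dots,z_n]$ be multiaffine real stable polynomials such that $p\ast q$ is not the zero polynomial. Let $\mathbf{a}$ and $\mathbf{b}$ be above the roots of $p$ and $q$ respectively, and let $\varphi_1,\varphi_2\in\mathbb{R}$ satisfy $$\frac{\partial_i p}{p}(\mathbf{a})\le\varphi_1,\qquad \frac{\partial_i q}{q}(\mathbf{b})\le\varphi_2,\qquad i=1,\dots,n.$$ Then the point $$\mathbf{c}=\mathbf{a}+\mathbf{b}-\frac{1}{\varphi_1+\varphi_2}\mathbf{1}$$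 is above the roots of $p\ast q$, and moreover $$\frac{\partial_i(p\ast q)}{p\ast q}(\mathbf{c})\le\frac{\varphi_1+\varphi_2}{2},\qquad i=1,\dots,n.$$ (For $n\ge 1$ the hypotheses force $\varphi_1+\varphi_2>0$.) -/

import Mathlib

namespace StableConvolution

/-- A polynomial with real coefficients is real stable if it has no zero all of whose coordinates
lie in the open upper half plane. -/
def IsRealStable {n : ℕ} (p : MvPolynomial (Fin n) ℝ) : Prop :=
  ∀ z : Fin n → ℂ, (∀ i, 0 < (z i).im) → MvPolynomial.aeval z p ≠ 0

/-- A polynomial is multiaffine if its degree in each single variable is at most one. -/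
def IsMultiaffine {n : ℕ} (p : MvPolynomial (Fin n) ℝ) : Prop :=
  ∀ i, p.degreeOf i ≤ 1

/-- The point `a` is above the roots of `p` if `p` does not vanish on `a` plus the closed
nonnegative orthant. -/
def AboveRoots {n : ℕ} (p : MvPolynomial (Fin n) ℝ) (a : Fin n → ℝ) : Prop :=
  ∀ t : Fin n → ℝ, (∀ i, 0 ≤ t i) → MvPolynomial.eval (a + t) p ≠ 0

/-- The logarithmic potential `(∂ₖ p / p)(a)`. -/
noncomputable def potential {n : ℕ} (p : MvPolynomial (Fin n) ℝ) (k : Fin n)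
    (a : Fin n → ℝ) : ℝ :=
  MvPolynomial.eval a (MvPolynomial.pderiv k p) / MvPolynomial.eval a p

/-- The mixed partial derivative `∂ⁿ f / ∂z₁ ⋯ ∂zₙ`, once in each variable. -/
noncomputable def mixedDeriv {n : ℕ} (f : MvPolynomial (Fin n) ℝ) : MvPolynomial (Fin n) ℝ :=
  (List.finRange n).foldr (fun i g => MvPolynomial.pderiv i g) f

/-- The convolution of `p` and `q`: the polynomial `p ∗ q` determined by
`(p ∗ q)(2z) = [∂ⁿ (p q) / ∂z₁ ⋯ ∂zₙ](z)`, that is, the mixed derivative of `p q` with `z / 2`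
substituted for `z`. -/
noncomputable def convolution {n : ℕ} (p q : MvPolynomial (Fin n) ℝ) :
    MvPolynomial (Fin n) ℝ :=
  MvPolynomial.aeval (fun i => MvPolynomial.C (1 / 2 : ℝ) * MvPolynomial.X i) (mixedDeriv (p * q))

/-- The defining property of the convolution. -/
theorem eval_convolution_two_mul {n : ℕ} (p q : MvPolynomial (Fin n) ℝ) (z : Fin n → ℝ) :
    MvPolynomial.eval (fun i => 2 * z i) (convolution p q)
      = MvPolynomial.eval z (mixedDeriv (p * q)) := by
  unfold convolution
  generalize mixedDeriv (p * q) = f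
  induction f using MvPolynomial.induction_on with
  | C a => simp
  | add f g hf hg => simp only [map_add, hf, hg]
  | mul_X f i hf =>
    simp only [map_mul, hf, MvPolynomial.aeval_X, MvPolynomial.eval_C, MvPolynomial.eval_X]
    ring

end StableConvolution


/-!
Give `p` and `q` separate variables `x` and `y`. The polynomial `∏ᵢ (∂/∂xᵢ + ∂/∂yᵢ) p(x) q(y)` is
multiaffine and depends on `x + y` only, and its value is that of the convolution at `x + y`. It
therefore suffices to follow a point above the roots, starting at `(a, b)`, while the operators
`∂/∂xᵢ + ∂/∂yᵢ` are applied one at a time.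

Let `w` be above the roots of a stable multiaffine `P`, with potentials `β`, `γ` in `xᵢ`, `yᵢ`, and
let `δ` be the value of `∂²P/∂xᵢ∂yᵢ / P` at `w`. The Rayleigh inequality gives `δ ≤ βγ` and makes
the potentials decreasing. After lowering `xᵢ` by `h`, the value of the new polynomial is
`P(w) (β + γ - hδ)`, which does not vanish for `h = 1/(φ₁ + φ₂)`. Two further Rayleigh inequalities
show that no potential of the new polynomial exceeds the old one, so the step can be repeated with
the same `φ₁`, `φ₂`, whereas the potential in `xᵢ` itself becomes `δ/(β + γ - hδ)`.
-/

namespace StableConvolution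

open MvPolynomial ComplexConjugate

section CoordinateMoves

theorem forall_mem_pi_of_forall_add_single {ι K : Type*} [Finite ι] [DecidableEq ι] [AddCommGroup K]
    {S : ι → Set K} {motive : (ι → K) → Prop} {x : ι → K} (hx : x ∈ Set.univ.pi S)
    (base : motive x)
    (move : ∀ y ∈ Set.univ.pi S, motive y → ∀ i, y i = x i → ∀ t, x i + t ∈ S i →
      motive (y + Pi.single i t))
    {y : ι → K} (hy : y ∈ Set.univ.pi S) : motive y := by
  have := Fintype.ofFinite ι
  suffices h : ∀ s : Finset ι, motive (s.piecewise y x) by simpa using h Finset.univ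
  intro s
  induction s using Finset.induction_on with
  | empty => simpa using base
  | insert i s hi ih =>
    have hmem : s.piecewise y x ∈ Set.univ.pi S := fun j hj =>
      Finset.piecewise_cases s y x (· ∈ S j) (hy j hj) (hx j hj)
    have hstep : (insert i s).piecewise y x = s.piecewise y x + Pi.single i (y i - x i) := by
      ext j
      rcases eq_or_ne j i with rfl | hj
      · simp [hi]
      · simp [Finset.piecewise, hj]
    rw [hstep]
    exact move _ hmem ih i (by simp [hi]) _ (by simpa using hy i trivial)

theorem antitoneOn_Ici_of_add_single_le {ι K β : Type*} [Finite ι] [DecidableEq ι] [AddCommGroup K]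
    [PartialOrder K] [IsOrderedAddMonoid K] [Preorder β] {f : (ι → K) → β} {a : ι → K}
    (h : ∀ x, a ≤ x → ∀ i t, 0 ≤ t → f (x + Pi.single i t) ≤ f x) :
    AntitoneOn f (Set.Ici a) := by
  intro x hax y _ hxy
  refine forall_mem_pi_of_forall_add_single (S := fun i => Set.Ici (x i))
    (motive := fun z => f z ≤ f x) (fun _ _ => le_rfl) le_rfl
    (fun z hz hzx i _ t ht => ?_) fun i _ => hxy i
  exact (h z (hax.trans fun j => hz j trivial) i t (le_add_iff_nonneg_right _ |>.1 ht)).trans hzx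

end CoordinateMoves

section PartialDerivatives

variable {σ τ R A : Type*}

theorem pderiv_comm [CommSemiring R] (i j : σ) (p : MvPolynomial σ R) :
    pderiv i (pderiv j p) = pderiv j (pderiv i p) := by
  classical
  ext m
  rcases eq_or_ne i j with rfl | hij
  · rfl
  · simp only [coeff_pderiv, Finsupp.add_apply, Finsupp.single_eq_of_ne hij,
      Finsupp.single_eq_of_ne hij.symm, add_right_comm m]
    push_cast
    ring

theorem degreeOf_pderiv_le [CommSemiring R] (i j : σ) (p : MvPolynomial σ R) :
    degreeOf j (pderiv i p) ≤ degreeOf j p := by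
  refine degreeOf_le_iff.2 fun m hm => ?_
  rw [mem_support_iff, coeff_pderiv] at hm
  have := monomial_le_degreeOf j (mem_support_iff.2 (left_ne_zero_of_mul hm))
  simp only [Finsupp.add_apply] at this
  omega

theorem pderiv_pderiv_self_of_degreeOf_le_one [CommSemiring R] {i : σ} {p : MvPolynomial σ R}
    (hp : degreeOf i p ≤ 1) : pderiv i (pderiv i p) = 0 := by
  classical
  ext m
  have hm : coeff (m + Finsupp.single i 1 + Finsupp.single i 1) p = 0 := by
    by_contra h
    have := degreeOf_le_iff.1 hp _ (mem_support_iff.2 h)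
    simp at this
  simp only [coeff_pderiv, hm, zero_mul, coeff_zero]

theorem aeval_add_single_of_degreeOf_le_one [DecidableEq σ] [CommSemiring R] [CommSemiring A]
    [Algebra R A] {i : σ} {p : MvPolynomial σ R} (hp : degreeOf i p ≤ 1) (z : σ → A) (t : A) :
    aeval (z + Pi.single i t) p = aeval z p + t * aeval z (pderiv i p) := by
  have hmonomial : ∀ m ∈ p.support, aeval (z + Pi.single i t) (monomial m (coeff m p))
      = aeval z (monomial m (coeff m p)) + t * aeval z (pderiv i (monomial m (coeff m p))) := by
    intro m hm
    have hmi : m i ≤ 1 := degreeOf_le_iff.1 hp m hm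
    have hfactor : monomial m (coeff m p) = monomial (m.erase i) (coeff m p) * X i ^ m i := by
      rw [X_pow_eq_monomial, monomial_mul, Finsupp.erase_add_single, mul_one]
    have hother : aeval (z + Pi.single i t) (monomial (m.erase i) (coeff m p))
        = aeval z (monomial (m.erase i) (coeff m p)) := by
      simp only [aeval_monomial]
      congr 1
      refine Finsupp.prod_congr fun j hj => ?_
      have hji : j ≠ i := Finset.ne_of_mem_erase (Finsupp.support_erase (a := i) (f := m) ▸ hj)
      simp [hji]
    have hvars : pderiv i (monomial (m.erase i) (coeff m p)) = 0 := by
      simp [pderiv_monomial]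
    rw [hfactor, map_mul, hother, pderiv_mul, hvars]
    interval_cases m i
    · simp
    · simp only [pow_one, aeval_X, Pi.add_apply, Pi.single_eq_same, map_mul, zero_mul,
        pderiv_X, mul_one, zero_add]
      ring
  conv_lhs => rw [p.as_sum]
  conv_rhs => rw [p.as_sum]
  simp only [map_sum, Finset.mul_sum]
  rw [← Finset.sum_add_distrib]
  exact Finset.sum_congr rfl hmonomial

theorem pderiv_aeval [Fintype σ] [CommSemiring R] (g : σ → MvPolynomial τ R) (i : τ)
    (p : MvPolynomial σ R) :
    pderiv i (aeval g p) = ∑ j, aeval g (pderiv j p) * pderiv i (g j) := by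
  classical
  induction p using MvPolynomial.induction_on with
  | C a => simp
  | add p q hp hq => simp only [map_add, hp, hq, add_mul, Finset.sum_add_distrib]
  | mul_X p k hp =>
    simp only [map_mul, aeval_X, Derivation.leibniz, hp, smul_eq_mul, map_add, add_mul,
      Finset.sum_add_distrib, pderiv_X, Finset.mul_sum]
    simp [Pi.single_apply, apply_ite, mul_assoc]

theorem pderiv_rename_eq_rename_sum [Fintype σ] [DecidableEq τ] [CommSemiring R] (f : σ → τ)
    (i : τ) (p : MvPolynomial σ R) :
    pderiv i (rename f p) = rename f (∑ j with f j = i, pderiv j p) := by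
  have hrename (r : MvPolynomial σ R) : rename f r = aeval (X ∘ f) r := by
    rw [← aeval_rename, aeval_X_left_apply]
  rw [hrename, pderiv_aeval, map_sum, Finset.sum_filter]
  exact Finset.sum_congr rfl fun j _ => by simp [hrename, pderiv_X, Pi.single_apply]

end PartialDerivatives

section Multiaffine

variable {n : ℕ} {p q : MvPolynomial (Fin n) ℝ}

protected theorem IsMultiaffine.add (hp : IsMultiaffine p) (hq : IsMultiaffine q) :
    IsMultiaffine (p + q) := fun i =>
  (degreeOf_add_le i p q).trans (max_le (hp i) (hq i))

protected theorem IsMultiaffine.pderiv (hp : IsMultiaffine p) (i : Fin n) :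
    IsMultiaffine (pderiv i p) := fun j =>
  (degreeOf_pderiv_le i j p).trans (hp j)

theorem IsMultiaffine.pderiv_pderiv_self (hp : IsMultiaffine p) (i : Fin n) :
    MvPolynomial.pderiv i (MvPolynomial.pderiv i p) = 0 :=
  pderiv_pderiv_self_of_degreeOf_le_one (hp i)

theorem IsMultiaffine.aeval_add_single {A : Type*} [CommSemiring A] [Algebra ℝ A]
    (hp : IsMultiaffine p) (i : Fin n) (z : Fin n → A) (t : A) :
    aeval (z + Pi.single i t) p = aeval z p + t * aeval z (MvPolynomial.pderiv i p) :=
  aeval_add_single_of_degreeOf_le_one (hp i) z t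

theorem IsMultiaffine.eval_add_single (hp : IsMultiaffine p) (i : Fin n) (x : Fin n → ℝ) (t : ℝ) :
    eval (x + Pi.single i t) p = eval x p + t * eval x (MvPolynomial.pderiv i p) := by
  simpa only [aeval_eq_eval] using hp.aeval_add_single i x t

end Multiaffine

section Stability

variable {n m : ℕ} {p q : MvPolynomial (Fin n) ℝ}

protected theorem IsRealStable.mul (hp : IsRealStable p) (hq : IsRealStable q) :
    IsRealStable (p * q) := fun z hz => by
  simpa only [map_mul] using mul_ne_zero (hp z hz) (hq z hz)

protected theorem IsRealStable.rename (hp : IsRealStable p) (f : Fin n → Fin m) :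
    IsRealStable (rename f p) := fun z hz => by
  simpa only [aeval_rename] using hp (z ∘ f) fun i => hz (f i)

theorem im_pos_add_single {z : Fin n → ℂ} (hz : ∀ i, 0 < (z i).im) {i : Fin n} {t : ℂ}
    (ht : 0 < (z i + t).im) (j : Fin n) : 0 < ((z + Pi.single i t : Fin n → ℂ) j).im := by
  rcases eq_or_ne j i with rfl | hj
  · simpa using ht
  · simpa [hj] using hz j

theorem IsRealStable.im_mul_conj_pderiv_nonneg_of_im_pos (hp : IsRealStable p)
    (hpa : IsMultiaffine p) (i : Fin n) {z : Fin n → ℂ} (hz : ∀ i, 0 < (z i).im) :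
    0 ≤ (aeval z p * conj (aeval z (pderiv i p))).im := by
  by_contra! hneg
  set d := aeval z (pderiv i p)
  have hd : d ≠ 0 := by
    intro h
    simp [h] at hneg
  have hroot : (aeval z p / d).im < 0 := by
    rw [div_eq_mul_inv, Complex.inv_def, ← mul_assoc, Complex.im_mul_ofReal]
    exact mul_neg_of_neg_of_pos hneg (inv_pos.2 (Complex.normSq_pos.2 hd))
  refine hp (z + Pi.single i (-(aeval z p / d))) (im_pos_add_single hz ?_) ?_
  · simpa using hroot.trans (hz i)
  · rw [hpa.aeval_add_single, neg_mul, div_mul_cancel₀ _ hd, add_neg_cancel]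

theorem IsRealStable.aeval_pderiv_eq_zero (hp : IsRealStable p) (hpa : IsMultiaffine p)
    (hqa : IsMultiaffine q)
    (hpq : ∀ z : Fin n → ℂ, (∀ i, 0 < (z i).im) → 0 ≤ (aeval z p * conj (aeval z q)).im)
    {z : Fin n → ℂ} (hz : ∀ i, 0 < (z i).im) (hqz : aeval z q = 0) (j : Fin n) :
    aeval z (pderiv j q) = 0 := by
  by_contra he
  set d := aeval z (pderiv j p)
  set e := aeval z (pderiv j q)
  -- The displacement of `z j` at which `q / p` takes the value `τ I`.
  let s : ℝ → ℂ := fun τ => τ * Complex.I * aeval z p / (e - τ * Complex.I * d)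
  have hden : ContinuousAt (fun τ : ℝ => e - τ * Complex.I * d) 0 := by fun_prop
  have hden_ne : ∀ᶠ τ : ℝ in nhds 0, e - τ * Complex.I * d ≠ 0 :=
    hden.eventually_ne (by simpa using he)
  have hs : ContinuousAt (fun τ => (z j + s τ).im) 0 := by
    refine Complex.continuous_im.continuousAt.comp (continuousAt_const.add ?_)
    exact ContinuousAt.div (by fun_prop) hden (by simpa using he)
  have hs_pos : ∀ᶠ τ in nhds 0, 0 < (z j + s τ).im :=
    hs.eventually (lt_mem_nhds (by simpa [s] using hz j))
  obtain ⟨τ, ⟨hτ_den, hτ_im⟩, hτ⟩ :=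
    (((hden_ne.and hs_pos).filter_mono nhdsWithin_le_nhds).and
      (self_mem_nhdsWithin (s := Set.Ioi (0 : ℝ)))).exists
  set w := z + Pi.single j (s τ)
  have hw : ∀ i, 0 < (w i).im := im_pos_add_single hz hτ_im
  have hvalue : aeval w q = τ * Complex.I * aeval w p := by
    rw [hqa.aeval_add_single, hpa.aeval_add_single, hqz]
    simp only [s]
    field_simp
    ring
  have hnormSq : 0 < Complex.normSq (aeval w p) := Complex.normSq_pos.2 (hp w hw)
  have him : (aeval w p * conj (aeval w q)).im = -(τ * Complex.normSq (aeval w p)) := by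
    rw [hvalue, map_mul, mul_left_comm, Complex.mul_conj]
    simp
  have := hpq w hw
  rw [him] at this
  exact absurd (mul_pos hτ hnormSq) (by linarith)

theorem eq_zero_of_aeval_eq_zero_of_im_pos
    (h : ∀ z : Fin n → ℂ, (∀ i, 0 < (z i).im) → aeval z q = 0) : q = 0 := by
  have hinf : {w : ℂ | 0 < w.im}.Infinite :=
    infinite_of_mem_nhds Complex.I ((isOpen_lt continuous_const Complex.continuous_im).mem_nhds
      (by simp))
  refine map_injective _ (algebraMap ℝ ℂ).injective
    (funext_set (fun _ => {w : ℂ | 0 < w.im}) (fun _ => hinf) fun z hz => ?_)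
  simpa [eval_map, aeval_def] using h z fun i => hz i trivial

theorem IsRealStable.of_im_mul_conj_nonneg (hp : IsRealStable p) (hpa : IsMultiaffine p)
    (hqa : IsMultiaffine q) (hq : q ≠ 0)
    (hpq : ∀ z : Fin n → ℂ, (∀ i, 0 < (z i).im) → 0 ≤ (aeval z p * conj (aeval z q)).im) :
    IsRealStable q := by
  -- A zero of `q` propagates along every coordinate, so a single zero would force `q = 0`.
  intro z hz hqz
  refine hq (eq_zero_of_aeval_eq_zero_of_im_pos fun w hw => ?_)
  refine forall_mem_pi_of_forall_add_single (S := fun _ => {w : ℂ | 0 < w.im})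
    (motive := fun y => aeval y q = 0) (fun i _ => hz i) hqz (fun y hy hqy i _ t _ => ?_)
    fun i _ => hw i
  rw [hqa.aeval_add_single, hqy,
    hp.aeval_pderiv_eq_zero hpa hqa hpq (fun i => hy i trivial) hqy, mul_zero, add_zero]

theorem IsRealStable.pderiv_add_pderiv (hp : IsRealStable p) (hpa : IsMultiaffine p)
    {i j : Fin n} (hne : pderiv i p + pderiv j p ≠ 0) :
    IsRealStable (pderiv i p + pderiv j p) := by
  refine hp.of_im_mul_conj_nonneg hpa ((hpa.pderiv i).add (hpa.pderiv j)) hne fun z hz => ?_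
  rw [map_add, map_add, mul_add, Complex.add_im]
  exact add_nonneg (hp.im_mul_conj_pderiv_nonneg_of_im_pos hpa i hz)
    (hp.im_mul_conj_pderiv_nonneg_of_im_pos hpa j hz)

theorem IsRealStable.im_mul_conj_pderiv_nonneg (hp : IsRealStable p) (hpa : IsMultiaffine p)
    (i : Fin n) {z : Fin n → ℂ} (hz : ∀ i, 0 ≤ (z i).im) :
    0 ≤ (aeval z p * conj (aeval z (pderiv i p))).im := by
  have hclosure : z ∈ closure (Set.univ.pi fun _ : Fin n => {w : ℂ | 0 < w.im}) := by
    rw [closure_pi_set, Set.mem_univ_pi]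
    simpa [Complex.closure_setOfPred_lt_im] using hz
  have hcont (f : MvPolynomial (Fin n) ℝ) : Continuous fun z : Fin n → ℂ => aeval z f := by
    simp only [aeval_def, eval₂_eq']
    fun_prop
  refine closure_minimal (fun w hw => ?_) (isClosed_le continuous_const
    (Complex.continuous_im.comp ((hcont p).mul (Complex.continuous_conj.comp (hcont _))))) hclosure
  exact hp.im_mul_conj_pderiv_nonneg_of_im_pos hpa i fun j => hw j trivial

theorem IsRealStable.eval_mul_eval_pderiv_pderiv_le (hp : IsRealStable p) (hpa : IsMultiaffine p)
    (i j : Fin n) (x : Fin n → ℝ) :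
    eval x p * eval x (pderiv i (pderiv j p)) ≤ eval x (pderiv i p) * eval x (pderiv j p) := by
  have hreal (f : MvPolynomial (Fin n) ℝ) : aeval (fun k => (x k : ℂ)) f = (eval x f : ℂ) :=
    aeval_algebraMap_apply ℂ x f
  have him := hp.im_mul_conj_pderiv_nonneg hpa j
    (z := (fun k => (x k : ℂ)) + Pi.single i Complex.I) fun k => by
      rcases eq_or_ne k i with rfl | hk
      · simp
      · simp [hk]
  rw [hpa.aeval_add_single, (hpa.pderiv j).aeval_add_single] at him
  simp only [hreal, map_add, Complex.conj_ofReal, map_mul, Complex.conj_I, neg_mul, Complex.mul_im,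
    Complex.add_re, Complex.ofReal_re, Complex.mul_re, Complex.I_re, zero_mul, Complex.I_im,
    Complex.ofReal_im, mul_zero, sub_self, add_zero, Complex.add_im, Complex.neg_im, one_mul,
    zero_add, mul_neg, Complex.neg_re, neg_zero, le_neg_add_iff_add_le] at him
  linarith

end Stability

section AboveRoots

variable {n : ℕ} {p : MvPolynomial (Fin n) ℝ} {a x : Fin n → ℝ}

theorem AboveRoots.eval_ne_zero (ha : AboveRoots p a) (hx : a ≤ x) : eval x p ≠ 0 := by
  simpa using ha (x - a) fun i => sub_nonneg.2 (hx i)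

theorem aboveRoots_of_forall_eval_ne_zero (h : ∀ x, a ≤ x → eval x p ≠ 0) : AboveRoots p a :=
  fun t ht => h (a + t) (le_add_of_nonneg_right ht)

theorem AboveRoots.mono (ha : AboveRoots p a) (hx : a ≤ x) : AboveRoots p x :=
  aboveRoots_of_forall_eval_ne_zero fun _ hy => ha.eval_ne_zero (hx.trans hy)

theorem le_add_single {i : Fin n} {t : ℝ} (hx : a ≤ x) (ht : 0 ≤ t) : a ≤ x + Pi.single i t :=
  hx.trans (le_add_of_nonneg_right (Pi.single_nonneg.2 ht))

theorem AboveRoots.potential_nonneg (ha : AboveRoots p a) (hpa : IsMultiaffine p) (i : Fin n) :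
    0 ≤ potential p i a := by
  have hp : eval a p ≠ 0 := ha.eval_ne_zero le_rfl
  by_contra! hneg
  refine ha.eval_ne_zero (le_add_single le_rfl (i := i) (inv_nonneg.2 (neg_nonneg.2 hneg.le))) ?_
  have hd : eval a (pderiv i p) = potential p i a * eval a p := (div_mul_cancel₀ _ hp).symm
  rw [hpa.eval_add_single, hd, ← mul_assoc, inv_neg, neg_mul, inv_mul_cancel₀ hneg.ne]
  ring

theorem AboveRoots.one_add_mul_potential_pos (ha : AboveRoots p a) (hpa : IsMultiaffine p)
    (i : Fin n) {t : ℝ} (ht : 0 ≤ t) : 0 < 1 + t * potential p i a := by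
  have := mul_nonneg ht (ha.potential_nonneg hpa i)
  positivity

theorem AboveRoots.potential_add_single (ha : AboveRoots p a) (hpa : IsMultiaffine p)
    (i j : Fin n) (t : ℝ) :
    potential p i (a + Pi.single j t)
      = (potential p i a + t * (eval a (pderiv i (pderiv j p)) / eval a p))
        / (1 + t * potential p j a) := by
  have hp : eval a p ≠ 0 := ha.eval_ne_zero le_rfl
  simp only [potential, hpa.eval_add_single, (hpa.pderiv i).eval_add_single, pderiv_comm i j]
  rw [← mul_div_mul_right (_ + _) (1 + _) hp]
  congr 1 <;> field_simp

theorem AboveRoots.eval_pderiv_pderiv_div_nonneg (ha : AboveRoots p a) (hpa : IsMultiaffine p)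
    (i j : Fin n) : 0 ≤ eval a (pderiv i (pderiv j p)) / eval a p := by
  by_contra! hneg
  set δ := eval a (pderiv i (pderiv j p)) / eval a p
  have ht : 0 ≤ (potential p i a + 1) / -δ :=
    div_nonneg (add_nonneg (ha.potential_nonneg hpa i) zero_le_one) (neg_nonneg.2 hneg.le)
  have hpos := (ha.mono (le_add_single le_rfl (i := j) ht)).potential_nonneg hpa i
  rw [ha.potential_add_single hpa, le_div_iff₀ (ha.one_add_mul_potential_pos hpa j ht), zero_mul,
    div_neg, neg_mul, div_mul_cancel₀ _ hneg.ne] at hpos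
  linarith

theorem AboveRoots.eval_pderiv_pderiv_div_le (ha : AboveRoots p a) (hp : IsRealStable p)
    (hpa : IsMultiaffine p) (i j : Fin n) :
    eval a (pderiv i (pderiv j p)) / eval a p ≤ potential p i a * potential p j a := by
  have hp0 : eval a p ≠ 0 := ha.eval_ne_zero le_rfl
  rw [potential, potential, div_mul_div_comm, ← mul_div_mul_left _ (eval a p) hp0]
  exact div_le_div_of_nonneg_right (hp.eval_mul_eval_pderiv_pderiv_le hpa i j a)
    (mul_self_nonneg _)

theorem AboveRoots.antitoneOn_potential (ha : AboveRoots p a) (hp : IsRealStable p)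
    (hpa : IsMultiaffine p) (i : Fin n) : AntitoneOn (potential p i) (Set.Ici a) := by
  refine antitoneOn_Ici_of_add_single_le fun x hax j t ht => ?_
  have hx := ha.mono hax
  rw [hx.potential_add_single hpa, div_le_iff₀ (hx.one_add_mul_potential_pos hpa j ht)]
  linarith [mul_le_mul_of_nonneg_left (hx.eval_pderiv_pderiv_div_le hp hpa i j) ht]

theorem AboveRoots.potential_add_potential_pos (ha : AboveRoots p a) (hp : IsRealStable p)
    (hpa : IsMultiaffine p) {i j : Fin n} (hne : pderiv i p + pderiv j p ≠ 0) :
    0 < potential p i a + potential p j a := by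
  have hi := ha.potential_nonneg hpa i
  have hj := ha.potential_nonneg hpa j
  by_contra! hle
  have hzero {k : Fin n} (hk : potential p k a ≤ 0) {x : Fin n → ℝ} (hx : a ≤ x) :
      eval x (pderiv k p) = 0 := by
    have hpot : potential p k x = 0 := le_antisymm
      ((ha.antitoneOn_potential hp hpa k Set.self_mem_Ici hx hx).trans hk)
      ((ha.mono hx).potential_nonneg hpa k)
    exact (div_eq_zero_iff.1 hpot).resolve_right (ha.eval_ne_zero hx)
  refine hne (funext_set (fun k => Set.Ici (a k)) (fun k => Set.Ici_infinite (a k))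
    fun x hx => ?_)
  have hax : a ≤ x := fun k => hx k trivial
  rw [map_add, hzero (by linarith) hax, hzero (by linarith) hax, add_zero, map_zero]

end AboveRoots

section BarrierStep

variable {n : ℕ} {p : MvPolynomial (Fin n) ℝ} {w : Fin n → ℝ} {i j : Fin n} {φ : ℝ}

theorem IsMultiaffine.eval_sub_single_pderiv_add_pderiv (hpa : IsMultiaffine p) (i j : Fin n)
    (w : Fin n → ℝ) (h : ℝ) :
    eval (w - Pi.single i h) (MvPolynomial.pderiv i p + MvPolynomial.pderiv j p)
      = eval w (MvPolynomial.pderiv i p) + eval w (MvPolynomial.pderiv j p)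
        - h * eval w (MvPolynomial.pderiv i (MvPolynomial.pderiv j p)) := by
  rw [sub_eq_add_neg, ← Pi.single_neg,
    ((hpa.pderiv i).add (hpa.pderiv j)).eval_add_single i, map_add, map_add,
    hpa.pderiv_pderiv_self, zero_add]
  ring

theorem AboveRoots.eval_pderiv_pderiv_div_mul_lt (hw : AboveRoots p w) (hp : IsRealStable p)
    (hpa : IsMultiaffine p) (hne : pderiv i p + pderiv j p ≠ 0)
    (hφ : potential p i w + potential p j w ≤ φ) :
    1 / φ * (eval w (pderiv i (pderiv j p)) / eval w p) < potential p i w + potential p j w := by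
  have hpos := hw.potential_add_potential_pos hp hpa hne
  have hmixed := hw.eval_pderiv_pderiv_div_le hp hpa i j
  rw [one_div_mul_eq_div, div_lt_iff₀ (hpos.trans_le hφ)]
  nlinarith [sq_nonneg (potential p i w - potential p j w)]

theorem AboveRoots.pderiv_add_pderiv (hw : AboveRoots p w) (hp : IsRealStable p)
    (hpa : IsMultiaffine p) (hne : pderiv i p + pderiv j p ≠ 0)
    (hφ : potential p i w + potential p j w ≤ φ) :
    AboveRoots (pderiv i p + pderiv j p) (w - Pi.single i (1 / φ)) := by
  refine aboveRoots_of_forall_eval_ne_zero fun x hx hzero => ?_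
  obtain ⟨v, hwv, rfl⟩ : ∃ v, w ≤ v ∧ v - Pi.single i (1 / φ) = x :=
    ⟨x + Pi.single i (1 / φ), sub_le_iff_le_add.1 hx, add_sub_cancel_right _ _⟩
  have hv := hw.mono hwv
  have hv0 : eval v p ≠ 0 := hv.eval_ne_zero le_rfl
  have hφv : potential p i v + potential p j v ≤ φ :=
    (add_le_add (hw.antitoneOn_potential hp hpa i Set.self_mem_Ici hwv hwv)
      (hw.antitoneOn_potential hp hpa j Set.self_mem_Ici hwv hwv)).trans hφ
  have hlt := hv.eval_pderiv_pderiv_div_mul_lt hp hpa hne hφv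
  rw [hpa.eval_sub_single_pderiv_add_pderiv] at hzero
  rw [potential, potential, ← add_div, ← mul_div_assoc, ← sub_pos, ← sub_div, hzero,
    zero_div] at hlt
  exact hlt.false

theorem AboveRoots.potential_pderiv_add_pderiv_sub_single (hw : AboveRoots p w)
    (hpa : IsMultiaffine p) (i j k : Fin n) (h : ℝ) :
    potential (pderiv i p + pderiv j p) k (w - Pi.single i h)
      = (eval w (pderiv i (pderiv k p)) / eval w p + eval w (pderiv j (pderiv k p)) / eval w p
          - h * (eval w (pderiv i (pderiv j (pderiv k p))) / eval w p))
        / (potential p i w + potential p j w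
          - h * (eval w (pderiv i (pderiv j p)) / eval w p)) := by
  have hw0 : eval w p ≠ 0 := hw.eval_ne_zero le_rfl
  rw [potential, map_add, pderiv_comm k i, pderiv_comm k j,
    (hpa.pderiv k).eval_sub_single_pderiv_add_pderiv, hpa.eval_sub_single_pderiv_add_pderiv,
    ← div_div_div_cancel_right₀ hw0]
  simp only [potential, sub_div, add_div, mul_div_assoc]

theorem AboveRoots.potential_pderiv_add_pderiv_sub_single_self (hw : AboveRoots p w)
    (hpa : IsMultiaffine p) (i j : Fin n) (h : ℝ) :
    potential (pderiv i p + pderiv j p) i (w - Pi.single i h)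
      = eval w (pderiv i (pderiv j p)) / eval w p
        / (potential p i w + potential p j w
          - h * (eval w (pderiv i (pderiv j p)) / eval w p)) := by
  rw [hw.potential_pderiv_add_pderiv_sub_single hpa, hpa.pderiv_pderiv_self, pderiv_comm j i,
    (hpa.pderiv j).pderiv_pderiv_self]
  simp

theorem AboveRoots.rayleigh_sub_single (hw : AboveRoots p w) (hp : IsRealStable p)
    (hpa : IsMultiaffine p) (i j k : Fin n) (h : ℝ) :
    (1 - h * potential p j w) *
        (eval w (pderiv i (pderiv k p)) / eval w p
          - h * (eval w (pderiv i (pderiv j (pderiv k p))) / eval w p))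
      ≤ (potential p i w - h * (eval w (pderiv i (pderiv j p)) / eval w p)) *
        (potential p k w - h * (eval w (pderiv j (pderiv k p)) / eval w p)) := by
  -- This is the Rayleigh inequality in the variables `i`, `k` at `w - h eⱼ`, divided by `p(w)²`.
  have hw0 : eval w p ≠ 0 := hw.eval_ne_zero le_rfl
  have hrayleigh := hp.eval_mul_eval_pderiv_pderiv_le hpa i k (w + Pi.single j (-h))
  rw [hpa.eval_add_single, (hpa.pderiv i).eval_add_single, (hpa.pderiv k).eval_add_single,
    ((hpa.pderiv k).pderiv i).eval_add_single, pderiv_comm j i, pderiv_comm j i] at hrayleigh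
  have hdiv := div_le_div_of_nonneg_right hrayleigh (mul_self_nonneg (eval w p))
  rw [mul_div_mul_comm, mul_div_mul_comm] at hdiv
  simpa only [potential, neg_mul, ← sub_eq_add_neg, sub_div, div_self hw0, mul_div_assoc]
    using hdiv

theorem add_sub_mul_le_of_rayleigh {R : Type*} [CommRing R] [PartialOrder R] [IsOrderedRing R]
    {α β γ δ β₁ γ₁ δ₁ h : R} (hh : 0 ≤ h) (hsum : h * (β + γ) = 1) (hδ : 0 ≤ δ)
    (hβ₁ : β₁ ≤ β * α) (hγ₁ : γ₁ ≤ γ * α)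
    (hβ : (1 - h * γ) * (β₁ - h * δ₁) ≤ (β - h * δ) * (α - h * γ₁))
    (hγ : (1 - h * β) * (γ₁ - h * δ₁) ≤ (γ - h * δ) * (α - h * β₁)) :
    β₁ + γ₁ - h * δ₁ ≤ α * (β + γ - h * δ) := by
  have hdrop : h * δ * (h * (β₁ + γ₁)) ≤ h * δ * α := by
    refine mul_le_mul_of_nonneg_left ?_ (mul_nonneg hh hδ)
    calc h * (β₁ + γ₁) ≤ h * (β * α + γ * α) := mul_le_mul_of_nonneg_left (add_le_add hβ₁ hγ₁) hh
      _ = α := by rw [← add_mul, ← mul_assoc, hsum, one_mul]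
  rw [show 1 - h * γ = h * β by rw [← hsum]; ring] at hβ
  rw [show 1 - h * β = h * γ by rw [← hsum]; ring] at hγ
  calc β₁ + γ₁ - h * δ₁
      = h * β * (β₁ - h * δ₁) + h * γ * (γ₁ - h * δ₁) + h * β * γ₁ + h * γ * β₁ := by
        linear_combination (h * δ₁ - β₁ - γ₁) * hsum
    _ ≤ (β - h * δ) * (α - h * γ₁) + (γ - h * δ) * (α - h * β₁) + h * β * γ₁ + h * γ * β₁ := by
        gcongr
    _ = α * (β + γ - h * δ) - h * δ * α + h * δ * (h * (β₁ + γ₁)) := by ring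
    _ ≤ α * (β + γ - h * δ) := by
        rw [sub_add]
        exact sub_le_self _ (sub_nonneg.2 hdrop)

theorem AboveRoots.potential_pderiv_add_pderiv_le (hw : AboveRoots p w) (hp : IsRealStable p)
    (hpa : IsMultiaffine p) (hne : pderiv i p + pderiv j p ≠ 0)
    (hφ : potential p i w + potential p j w ≤ φ) (k : Fin n) :
    potential (pderiv i p + pderiv j p) k (w - Pi.single i (1 / φ)) ≤ potential p k w := by
  -- With step length `1 / σ`, where `σ = β + γ`, the weights `1 - γ / σ` and `1 - β / σ` of the two
  -- Rayleigh inequalities are `β / σ` and `γ / σ`. Shorter steps follow as potentials decrease.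
  set σ := potential p i w + potential p j w
  have hσ_pos : 0 < σ := hw.potential_add_potential_pos hp hpa hne
  have hle : w - Pi.single i (1 / σ) ≤ w - Pi.single i (1 / φ) :=
    sub_le_sub_left (Pi.single_mono i (one_div_le_one_div_of_le hσ_pos hφ)) w
  refine ((hw.pderiv_add_pderiv hp hpa hne le_rfl).antitoneOn_potential
    (hp.pderiv_add_pderiv hpa hne) ((hpa.pderiv i).add (hpa.pderiv j)) k Set.self_mem_Ici
    hle hle).trans ?_
  rw [hw.potential_pderiv_add_pderiv_sub_single hpa,
    div_le_iff₀ (sub_pos.2 (hw.eval_pderiv_pderiv_div_mul_lt hp hpa hne le_rfl))]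
  have hray := hw.rayleigh_sub_single hp hpa j i k (1 / σ)
  rw [pderiv_comm j i, pderiv_comm j i] at hray
  exact add_sub_mul_le_of_rayleigh (one_div_nonneg.2 hσ_pos.le) (one_div_mul_cancel hσ_pos.ne')
    (hw.eval_pderiv_pderiv_div_nonneg hpa i j) (hw.eval_pderiv_pderiv_div_le hp hpa i k)
    (hw.eval_pderiv_pderiv_div_le hp hpa j k) (hw.rayleigh_sub_single hp hpa i j k (1 / σ)) hray

theorem div_add_sub_le {β γ δ φ₁ φ₂ : ℝ} (hβ : 0 ≤ β) (hγ : 0 ≤ γ) (hφ₁ : β ≤ φ₁) (hφ₂ : γ ≤ φ₂)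
    (hδ : δ ≤ β * γ) (hlt : 1 / (φ₁ + φ₂) * δ < β + γ) :
    δ / (β + γ - 1 / (φ₁ + φ₂) * δ)
      ≤ φ₁ * φ₂ * (φ₁ + φ₂) / (φ₁ ^ 2 + φ₁ * φ₂ + φ₂ ^ 2) := by
  have hφ₁_nonneg := hβ.trans hφ₁
  have hφ₂_nonneg := hγ.trans hφ₂
  have hpos : 0 < φ₁ + φ₂ := by
    refine (add_nonneg hφ₁_nonneg hφ₂_nonneg).lt_of_ne' fun h => ?_
    rw [h, div_zero, zero_mul] at hlt
    linarith
  have hden : 0 < φ₁ ^ 2 + φ₁ * φ₂ + φ₂ ^ 2 := by nlinarith [mul_nonneg hφ₁_nonneg hφ₂_nonneg]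
  have hmain : δ * (φ₁ + φ₂) ≤ φ₁ * φ₂ * (β + γ) :=
    calc δ * (φ₁ + φ₂) ≤ β * γ * (φ₁ + φ₂) := mul_le_mul_of_nonneg_right hδ hpos.le
      _ = β * φ₁ * γ + γ * φ₂ * β := by ring
      _ ≤ β * φ₁ * φ₂ + γ * φ₂ * φ₁ := by gcongr
      _ = φ₁ * φ₂ * (β + γ) := by ring
  rw [div_le_div_iff₀ (sub_pos.2 hlt) hden]
  calc δ * (φ₁ ^ 2 + φ₁ * φ₂ + φ₂ ^ 2) = (φ₁ + φ₂) * (δ * (φ₁ + φ₂)) - δ * (φ₁ * φ₂) := by ring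
    _ ≤ (φ₁ + φ₂) * (φ₁ * φ₂ * (β + γ)) - δ * (φ₁ * φ₂) := by gcongr
    _ = φ₁ * φ₂ * (φ₁ + φ₂) * (β + γ - 1 / (φ₁ + φ₂) * δ) := by field_simp

theorem AboveRoots.potential_pderiv_add_pderiv_le_div (hw : AboveRoots p w) (hp : IsRealStable p)
    (hpa : IsMultiaffine p) (hne : pderiv i p + pderiv j p ≠ 0) {φ₁ φ₂ : ℝ}
    (hφ₁ : potential p i w ≤ φ₁) (hφ₂ : potential p j w ≤ φ₂) :
    potential (pderiv i p + pderiv j p) i (w - Pi.single i (1 / (φ₁ + φ₂)))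
      ≤ φ₁ * φ₂ * (φ₁ + φ₂) / (φ₁ ^ 2 + φ₁ * φ₂ + φ₂ ^ 2) := by
  rw [hw.potential_pderiv_add_pderiv_sub_single_self hpa]
  exact div_add_sub_le (hw.potential_nonneg hpa i) (hw.potential_nonneg hpa j) hφ₁ hφ₂
    (hw.eval_pderiv_pderiv_div_le hp hpa i j)
    (hw.eval_pderiv_pderiv_div_mul_lt hp hpa hne (add_le_add hφ₁ hφ₂))

end BarrierStep

section SumDeriv

variable {ι : Type*} {n : ℕ}

/-- The polynomial `∏_{i ∈ L} (∂_{f i} + ∂_{g i}) P`. The operators commute; the list fixes the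
order in which they are applied, the head of `L` being the last. -/
noncomputable def sumDeriv (f g : ι → Fin n) (L : List ι) (P : MvPolynomial (Fin n) ℝ) :
    MvPolynomial (Fin n) ℝ :=
  L.foldr (fun i Q => pderiv (f i) Q + pderiv (g i) Q) P

variable {f g : ι → Fin n} {L : List ι} {P : MvPolynomial (Fin n) ℝ} {w : Fin n → ℝ}

theorem sumDeriv_cons (f g : ι → Fin n) (i : ι) (L : List ι) (P : MvPolynomial (Fin n) ℝ) :
    sumDeriv f g (i :: L) P
      = pderiv (f i) (sumDeriv f g L P) + pderiv (g i) (sumDeriv f g L P) :=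
  rfl

theorem sumDeriv_ne_zero_of_cons {i : ι} (h : sumDeriv f g (i :: L) P ≠ 0) :
    sumDeriv f g L P ≠ 0 := by
  intro h0
  simp [sumDeriv_cons, h0] at h

protected theorem IsMultiaffine.sumDeriv (hP : IsMultiaffine P) (f g : ι → Fin n) (L : List ι) :
    IsMultiaffine (sumDeriv f g L P) := by
  induction L with
  | nil => exact hP
  | cons i L ih => exact (ih.pderiv (f i)).add (ih.pderiv (g i))

protected theorem IsRealStable.sumDeriv (hP : IsRealStable P) (hPa : IsMultiaffine P)
    (hne : sumDeriv f g L P ≠ 0) : IsRealStable (sumDeriv f g L P) := by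
  induction L with
  | nil => exact hP
  | cons i L ih =>
    exact (ih (sumDeriv_ne_zero_of_cons hne)).pderiv_add_pderiv (hPa.sumDeriv f g L) hne

theorem IsMultiaffine.pderiv_sumDeriv_eq (hP : IsMultiaffine P) {i : ι} (hi : i ∈ L) :
    MvPolynomial.pderiv (f i) (sumDeriv f g L P)
      = MvPolynomial.pderiv (g i) (sumDeriv f g L P) := by
  induction L with
  | nil => cases hi
  | cons k L ih =>
    have hL := hP.sumDeriv f g L
    rw [sumDeriv_cons, map_add, map_add]
    rcases List.mem_cons.1 hi with rfl | hi
    · rw [hL.pderiv_pderiv_self, hL.pderiv_pderiv_self, zero_add, add_zero, pderiv_comm]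
    · rw [pderiv_comm (f i), pderiv_comm (f i), ih hi, pderiv_comm (g i), pderiv_comm (g i)]

theorem sub_sum_map_single_cons (w : Fin n → ℝ) (f : ι → Fin n) (c : ℝ) (i : ι) (L : List ι) :
    w - ((i :: L).map fun k => Pi.single (f k) c).sum
      = w - (L.map fun k => Pi.single (f k) c).sum - Pi.single (f i) c := by
  rw [List.map_cons, List.sum_cons, add_comm, sub_sub]

theorem AboveRoots.sumDeriv_barrier (hw : AboveRoots P w) (hP : IsRealStable P)
    (hPa : IsMultiaffine P) (hne : sumDeriv f g L P ≠ 0) {φ : ℝ}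
    (hφ : ∀ i ∈ L, potential P (f i) w + potential P (g i) w ≤ φ) :
    AboveRoots (sumDeriv f g L P) (w - (L.map fun i => Pi.single (f i) (1 / φ)).sum) ∧
      ∀ k, potential (sumDeriv f g L P) k (w - (L.map fun i => Pi.single (f i) (1 / φ)).sum)
        ≤ potential P k w := by
  induction L with
  | nil => simpa [sumDeriv] using hw
  | cons i L ih =>
    have hne' := sumDeriv_ne_zero_of_cons hne
    obtain ⟨habove, hpot⟩ := ih hne' fun k hk => hφ k (List.mem_cons_of_mem i hk)
    have hφi := (add_le_add (hpot (f i)) (hpot (g i))).trans (hφ i List.mem_cons_self)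
    rw [sub_sum_map_single_cons, sumDeriv_cons]
    exact ⟨habove.pderiv_add_pderiv (hP.sumDeriv hPa hne') (hPa.sumDeriv f g L) hne hφi,
      fun k => (habove.potential_pderiv_add_pderiv_le (hP.sumDeriv hPa hne') (hPa.sumDeriv f g L)
        hne hφi k).trans (hpot k)⟩

theorem AboveRoots.potential_sumDeriv_le_div (hw : AboveRoots P w) (hP : IsRealStable P)
    (hPa : IsMultiaffine P) (hne : sumDeriv f g L P ≠ 0) {φ₁ φ₂ : ℝ}
    (hφ₁ : ∀ i ∈ L, potential P (f i) w ≤ φ₁) (hφ₂ : ∀ i ∈ L, potential P (g i) w ≤ φ₂)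
    {i : ι} (hi : i ∈ L) :
    potential (sumDeriv f g L P) (f i)
        (w - (L.map fun k => Pi.single (f k) (1 / (φ₁ + φ₂))).sum)
      ≤ φ₁ * φ₂ * (φ₁ + φ₂) / (φ₁ ^ 2 + φ₁ * φ₂ + φ₂ ^ 2) := by
  induction L with
  | nil => cases hi
  | cons k L ih =>
    have hne' := sumDeriv_ne_zero_of_cons hne
    have hφ₁' : ∀ i ∈ L, potential P (f i) w ≤ φ₁ := fun l hl => hφ₁ l (List.mem_cons_of_mem k hl)
    have hφ₂' : ∀ i ∈ L, potential P (g i) w ≤ φ₂ := fun l hl => hφ₂ l (List.mem_cons_of_mem k hl)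
    obtain ⟨habove, hpot⟩ := hw.sumDeriv_barrier hP hPa hne' fun l hl =>
      add_le_add (hφ₁' l hl) (hφ₂' l hl)
    have hk₁ := (hpot (f k)).trans (hφ₁ k List.mem_cons_self)
    have hk₂ := (hpot (g k)).trans (hφ₂ k List.mem_cons_self)
    rw [sub_sum_map_single_cons, sumDeriv_cons]
    rcases List.mem_cons.1 hi with rfl | hi
    · exact habove.potential_pderiv_add_pderiv_le_div (hP.sumDeriv hPa hne')
        (hPa.sumDeriv f g L) hne hk₁ hk₂
    · exact (habove.potential_pderiv_add_pderiv_le (hP.sumDeriv hPa hne') (hPa.sumDeriv f g L)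
        hne (add_le_add hk₁ hk₂) (f i)).trans (ih hne' hφ₁' hφ₂' hi)

end SumDeriv

section ExternalProduct

variable {m n : ℕ} {p : MvPolynomial (Fin m) ℝ} {q : MvPolynomial (Fin n) ℝ}

/-- The polynomial `p(x) q(y)` in two disjoint groups of variables, those of `p` coming first. -/
noncomputable def externalProduct (p : MvPolynomial (Fin m) ℝ) (q : MvPolynomial (Fin n) ℝ) :
    MvPolynomial (Fin (m + n)) ℝ :=
  rename (Fin.castAdd n) p * rename (Fin.natAdd m) q

theorem castAdd_ne_natAdd (i : Fin m) (j : Fin n) : Fin.castAdd n i ≠ Fin.natAdd m j := by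
  intro h
  have := congrArg Fin.val h
  simp at this
  omega

theorem castAdd_notMem_vars_rename_natAdd (i : Fin m) :
    Fin.castAdd n i ∉ (rename (Fin.natAdd m) q).vars := fun h => by
  obtain ⟨j, -, hj⟩ := mem_vars_rename _ _ h
  exact castAdd_ne_natAdd i j hj.symm

theorem natAdd_notMem_vars_rename_castAdd (j : Fin n) :
    Fin.natAdd m j ∉ (rename (Fin.castAdd n) p).vars := fun h => by
  obtain ⟨i, -, hi⟩ := mem_vars_rename _ _ h
  exact castAdd_ne_natAdd i j hi

theorem eval_externalProduct (p : MvPolynomial (Fin m) ℝ) (q : MvPolynomial (Fin n) ℝ)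
    (x : Fin m → ℝ) (y : Fin n → ℝ) :
    eval (Fin.append x y) (externalProduct p q) = eval x p * eval y q := by
  simp [externalProduct, eval_rename, Function.comp_def]

theorem pderiv_castAdd_externalProduct (p : MvPolynomial (Fin m) ℝ) (q : MvPolynomial (Fin n) ℝ)
    (i : Fin m) :
    pderiv (Fin.castAdd n i) (externalProduct p q) = externalProduct (pderiv i p) q := by
  rw [externalProduct, pderiv_mul, pderiv_rename (Fin.castAdd_injective m n),
    pderiv_eq_zero_of_notMem_vars (castAdd_notMem_vars_rename_natAdd i), mul_zero, add_zero,
    externalProduct]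

theorem pderiv_natAdd_externalProduct (p : MvPolynomial (Fin m) ℝ) (q : MvPolynomial (Fin n) ℝ)
    (j : Fin n) :
    pderiv (Fin.natAdd m j) (externalProduct p q) = externalProduct p (pderiv j q) := by
  rw [externalProduct, pderiv_mul, pderiv_rename (Fin.natAdd_injective n m),
    pderiv_eq_zero_of_notMem_vars (natAdd_notMem_vars_rename_castAdd j), zero_mul, zero_add,
    externalProduct]

protected theorem IsMultiaffine.externalProduct (hp : IsMultiaffine p) (hq : IsMultiaffine q) :
    IsMultiaffine (externalProduct p q) := by
  intro k
  refine (degreeOf_mul_le _ _ _).trans ?_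
  induction k using Fin.addCases with
  | left i =>
    rw [degreeOf_rename_of_injective (Fin.castAdd_injective m n),
      not_not.1 (mt mem_vars_iff_degreeOf_ne_zero.2 (castAdd_notMem_vars_rename_natAdd i))]
    exact hp i
  | right j =>
    rw [degreeOf_rename_of_injective (Fin.natAdd_injective n m),
      not_not.1 (mt mem_vars_iff_degreeOf_ne_zero.2 (natAdd_notMem_vars_rename_castAdd j)),
      zero_add]
    exact hq j

protected theorem IsRealStable.externalProduct (hp : IsRealStable p) (hq : IsRealStable q) :
    IsRealStable (externalProduct p q) :=
  (hp.rename (Fin.castAdd n)).mul (hq.rename (Fin.natAdd m))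

protected theorem AboveRoots.externalProduct {a : Fin m → ℝ} {b : Fin n → ℝ} (ha : AboveRoots p a)
    (hb : AboveRoots q b) : AboveRoots (externalProduct p q) (Fin.append a b) := by
  refine aboveRoots_of_forall_eval_ne_zero fun x hx => ?_
  rw [← Fin.append_castAdd_natAdd (f := x), eval_externalProduct]
  exact mul_ne_zero
    (ha.eval_ne_zero fun i => by simpa using hx (Fin.castAdd n i))
    (hb.eval_ne_zero fun j => by simpa using hx (Fin.natAdd m j))

theorem potential_castAdd_externalProduct {y : Fin n → ℝ} (hy : eval y q ≠ 0) (i : Fin m)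
    (x : Fin m → ℝ) :
    potential (externalProduct p q) (Fin.castAdd n i) (Fin.append x y) = potential p i x := by
  simp only [potential, pderiv_castAdd_externalProduct, eval_externalProduct]
  exact mul_div_mul_right _ _ hy

theorem potential_natAdd_externalProduct {x : Fin m → ℝ} (hx : eval x p ≠ 0) (j : Fin n)
    (y : Fin n → ℝ) :
    potential (externalProduct p q) (Fin.natAdd m j) (Fin.append x y) = potential q j y := by
  simp only [potential, pderiv_natAdd_externalProduct, eval_externalProduct]
  exact mul_div_mul_left _ _ hx

end ExternalProduct

section DependenceOnSum

variable {n : ℕ}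

theorem IsMultiaffine.eval_add_single_sub_single {p : MvPolynomial (Fin n) ℝ}
    (hp : IsMultiaffine p) {i j : Fin n}
    (hij : MvPolynomial.pderiv i p = MvPolynomial.pderiv j p) (w : Fin n → ℝ) (t : ℝ) :
    eval (w + Pi.single i t - Pi.single j t) p = eval w p := by
  rw [sub_eq_add_neg, ← Pi.single_neg, hp.eval_add_single, hp.eval_add_single,
    (hp.pderiv j).eval_add_single, ← hij, hp.pderiv_pderiv_self, map_zero]
  ring

theorem IsMultiaffine.eval_append_eq_of_add_eq {p : MvPolynomial (Fin (n + n)) ℝ}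
    (hp : IsMultiaffine p)
    (hsymm : ∀ i, MvPolynomial.pderiv (Fin.castAdd n i) p = MvPolynomial.pderiv (Fin.natAdd n i) p)
    {u v u' v' : Fin n → ℝ} (h : u + v = u' + v') :
    eval (Fin.append u v) p = eval (Fin.append u' v') p := by
  suffices hshift : ∀ d, eval (Fin.append (u' + d) (v' - d)) p = eval (Fin.append u' v') p by
    have hv : v' - (u - u') = v := by
      rw [sub_sub_eq_add_sub, add_comm v', ← h, add_sub_cancel_left]
    simpa only [add_sub_cancel, hv] using hshift (u - u')
  intro d
  refine forall_mem_pi_of_forall_add_single (S := fun _ => Set.univ)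
    (motive := fun d => eval (Fin.append (u' + d) (v' - d)) p = eval (Fin.append u' v') p)
    (x := 0) (by simp) (by simp) (fun e _ he i _ t _ => ?_) (by simp)
  refine Eq.trans ?_ ((hp.eval_add_single_sub_single (hsymm i) _ t).trans he)
  congr 2
  ext k
  induction k using Fin.addCases with
  | left j => simp [-Fin.natAdd_eq_addNat, Pi.single_apply, castAdd_ne_natAdd, add_assoc]
  | right j =>
    simp [-Fin.natAdd_eq_addNat, Pi.single_apply, (castAdd_ne_natAdd _ _).symm, sub_sub]

end DependenceOnSum

section PolarizedConvolution

variable {n : ℕ} {p q : MvPolynomial (Fin n) ℝ}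

/-- The polynomial `∏ᵢ (∂/∂xᵢ + ∂/∂yᵢ) p(x) q(y)` in `2n` variables. It depends on `x + y` only,
and restricting it to `x = y` turns `∂/∂xᵢ + ∂/∂yᵢ` into `∂/∂zᵢ`, which gives the mixed derivative
of `p q`: hence its value at `(x, y)` is that of the convolution at `x + y`. -/
noncomputable def polarizedConvolution (p q : MvPolynomial (Fin n) ℝ) :
    MvPolynomial (Fin (n + n)) ℝ :=
  sumDeriv (Fin.castAdd n) (Fin.natAdd n) (List.finRange n) (externalProduct p q)

/-- The map of variables that identifies the two halves, so that renaming along it restricts a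
polynomial in `(x, y)` to the diagonal `x = y`. -/
def foldVars (n : ℕ) : Fin (n + n) → Fin n :=
  Fin.addCases id id

theorem comp_foldVars {α : Type*} (x : Fin n → α) : x ∘ foldVars n = Fin.append x x := by
  ext k
  induction k using Fin.addCases <;> simp [-Fin.natAdd_eq_addNat, foldVars]

theorem pderiv_rename_foldVars (i : Fin n) (P : MvPolynomial (Fin (n + n)) ℝ) :
    pderiv i (rename (foldVars n) P)
      = rename (foldVars n) (pderiv (Fin.castAdd n i) P + pderiv (Fin.natAdd n i) P) := by
  rw [pderiv_rename_eq_rename_sum, Finset.sum_filter, Fin.sum_univ_add]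
  simp [-Fin.natAdd_eq_addNat, foldVars]

theorem mixedDeriv_mul (p q : MvPolynomial (Fin n) ℝ) :
    mixedDeriv (p * q) = rename (foldVars n) (polarizedConvolution p q) := by
  have hfold : p * q = rename (foldVars n) (externalProduct p q) := by
    have hleft : foldVars n ∘ Fin.castAdd n = id := by ext; simp [foldVars]
    have hright : foldVars n ∘ Fin.natAdd n = id := by
      ext
      simp [-Fin.natAdd_eq_addNat, foldVars]
    simp [externalProduct, rename_rename, hleft, hright]
  rw [hfold]
  exact List.foldr_hom _ pderiv_rename_foldVars

theorem polarizedConvolution_ne_zero (h : convolution p q ≠ 0) : polarizedConvolution p q ≠ 0 := by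
  intro h0
  simp [convolution, mixedDeriv_mul, h0] at h

protected theorem IsMultiaffine.polarizedConvolution (hp : IsMultiaffine p) (hq : IsMultiaffine q) :
    IsMultiaffine (polarizedConvolution p q) :=
  (hp.externalProduct hq).sumDeriv _ _ _

theorem pderiv_castAdd_polarizedConvolution (hp : IsMultiaffine p) (hq : IsMultiaffine q)
    (i : Fin n) :
    pderiv (Fin.castAdd n i) (polarizedConvolution p q)
      = pderiv (Fin.natAdd n i) (polarizedConvolution p q) :=
  (hp.externalProduct hq).pderiv_sumDeriv_eq (List.mem_finRange i)

theorem IsMultiaffine.eval_rename_foldVars {P : MvPolynomial (Fin (n + n)) ℝ}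
    (hP : IsMultiaffine P)
    (hsymm : ∀ i, MvPolynomial.pderiv (Fin.castAdd n i) P = MvPolynomial.pderiv (Fin.natAdd n i) P)
    (u v : Fin n → ℝ) :
    eval (fun i => (u i + v i) / 2) (rename (foldVars n) P) = eval (Fin.append u v) P := by
  rw [eval_rename, comp_foldVars]
  exact hP.eval_append_eq_of_add_eq hsymm (funext fun i => add_halves _)

theorem eval_convolution (p q : MvPolynomial (Fin n) ℝ) (x : Fin n → ℝ) :
    eval x (convolution p q)
      = eval (fun i => x i / 2) (rename (foldVars n) (polarizedConvolution p q)) := by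
  rw [← mixedDeriv_mul, ← eval_convolution_two_mul]
  simp only [mul_div_cancel₀ _ (two_ne_zero' ℝ)]

theorem eval_pderiv_convolution (hp : IsMultiaffine p) (hq : IsMultiaffine q) (i : Fin n)
    (x : Fin n → ℝ) :
    eval x (pderiv i (convolution p q))
      = eval (fun i => x i / 2)
          (rename (foldVars n) (pderiv (Fin.castAdd n i) (polarizedConvolution p q))) := by
  have hscale (f : MvPolynomial (Fin n) ℝ) :
      eval x (aeval (fun j => C (1 / 2 : ℝ) * X j : Fin n → MvPolynomial (Fin n) ℝ) f)
        = eval (fun i => x i / 2) f := by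
    rw [← aeval_eq_eval, comp_aeval_apply, ← aeval_eq_eval]
    simp only [map_mul, aeval_C, aeval_X, Algebra.algebraMap_self, RingHom.id_apply,
      one_div_mul_eq_div]
  rw [convolution, mixedDeriv_mul, pderiv_aeval,
    Finset.sum_eq_single_of_mem i (Finset.mem_univ i) (fun j _ hj => by simp [hj]),
    map_mul, hscale, pderiv_rename_foldVars, ← pderiv_castAdd_polarizedConvolution hp hq]
  simp only [map_add, one_div, Derivation.leibniz, pderiv_X, Pi.single_eq_same, smul_eq_mul,
    mul_one, derivation_C, mul_zero, add_zero, eval_C]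
  ring

theorem eval_convolution_add (hp : IsMultiaffine p) (hq : IsMultiaffine q) (u v : Fin n → ℝ) :
    eval (u + v) (convolution p q) = eval (Fin.append u v) (polarizedConvolution p q) :=
  (eval_convolution p q _).trans ((hp.polarizedConvolution hq).eval_rename_foldVars
    (pderiv_castAdd_polarizedConvolution hp hq) u v)

theorem eval_pderiv_convolution_add (hp : IsMultiaffine p) (hq : IsMultiaffine q) (i : Fin n)
    (u v : Fin n → ℝ) :
    eval (u + v) (pderiv i (convolution p q))
      = eval (Fin.append u v) (pderiv (Fin.castAdd n i) (polarizedConvolution p q)) :=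
  (eval_pderiv_convolution hp hq i _).trans
    (((hp.polarizedConvolution hq).pderiv _).eval_rename_foldVars (fun j => by
      rw [pderiv_comm, pderiv_castAdd_polarizedConvolution hp hq j, pderiv_comm]) u v)

theorem potential_convolution_add (hp : IsMultiaffine p) (hq : IsMultiaffine q) (i : Fin n)
    (u v : Fin n → ℝ) :
    potential (convolution p q) i (u + v)
      = potential (polarizedConvolution p q) (Fin.castAdd n i) (Fin.append u v) := by
  rw [potential, eval_convolution_add hp hq, eval_pderiv_convolution_add hp hq, potential]

end PolarizedConvolution

section Convolution

variable {n : ℕ} {p q : MvPolynomial (Fin n) ℝ} {a b : Fin n → ℝ} {φ₁ φ₂ : ℝ}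

theorem append_sub_sum_map_single_castAdd (a b : Fin n → ℝ) (c : ℝ) :
    Fin.append a b - ((List.finRange n).map fun i => Pi.single (Fin.castAdd n i) c).sum
      = Fin.append (fun i => a i - c) b := by
  rw [← Fin.sum_univ_def]
  ext k
  induction k using Fin.addCases with
  | left i => simp [Pi.single_apply]
  | right i => simp [-Fin.natAdd_eq_addNat, (castAdd_ne_natAdd _ _).symm]

theorem AboveRoots.polarizedConvolution_barrier (ha : AboveRoots p a) (hb : AboveRoots q b)
    (hp : IsRealStable p) (hpa : IsMultiaffine p) (hq : IsRealStable q) (hqa : IsMultiaffine q)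
    (hne : polarizedConvolution p q ≠ 0) (hφ₁ : ∀ i, potential p i a ≤ φ₁)
    (hφ₂ : ∀ i, potential q i b ≤ φ₂) :
    AboveRoots (polarizedConvolution p q) (Fin.append (fun i => a i - 1 / (φ₁ + φ₂)) b) ∧
      ∀ i, potential (polarizedConvolution p q) (Fin.castAdd n i)
          (Fin.append (fun i => a i - 1 / (φ₁ + φ₂)) b)
        ≤ φ₁ * φ₂ * (φ₁ + φ₂) / (φ₁ ^ 2 + φ₁ * φ₂ + φ₂ ^ 2) := by
  have hleft (i : Fin n) :
      potential (externalProduct p q) (Fin.castAdd n i) (Fin.append a b) ≤ φ₁ := by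
    rw [potential_castAdd_externalProduct (hb.eval_ne_zero le_rfl)]
    exact hφ₁ i
  have hright (i : Fin n) :
      potential (externalProduct p q) (Fin.natAdd n i) (Fin.append a b) ≤ φ₂ := by
    rw [potential_natAdd_externalProduct (ha.eval_ne_zero le_rfl)]
    exact hφ₂ i
  have hstable := hp.externalProduct hq
  have haffine := hpa.externalProduct hqa
  rw [← append_sub_sum_map_single_castAdd]
  exact ⟨((ha.externalProduct hb).sumDeriv_barrier hstable haffine hne fun i _ =>
      add_le_add (hleft i) (hright i)).1,
    fun i => (ha.externalProduct hb).potential_sumDeriv_le_div hstable haffine hne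
      (fun i _ => hleft i) (fun i _ => hright i) (List.mem_finRange i)⟩

theorem AboveRoots.convolution_of_polarizedConvolution (hpa : IsMultiaffine p)
    (hqa : IsMultiaffine q) (h : AboveRoots (polarizedConvolution p q) (Fin.append a b)) :
    AboveRoots (convolution p q) (a + b) := by
  refine aboveRoots_of_forall_eval_ne_zero fun x hx => ?_
  rw [← sub_add_cancel x b, eval_convolution_add hpa hqa]
  refine h.eval_ne_zero fun k => ?_
  induction k using Fin.addCases with
  | left i => simpa using le_sub_iff_add_le.2 (hx i)
  | right i => simp [-Fin.natAdd_eq_addNat]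

theorem mul_mul_add_div_le_half_add {x y : ℝ} (h : 0 ≤ x + y) :
    x * y * (x + y) / (x ^ 2 + x * y + y ^ 2) ≤ (x + y) / 2 := by
  rcases eq_or_ne (x ^ 2 + x * y + y ^ 2) 0 with h0 | h0
  · rw [h0, div_zero]
    positivity
  · have hden : 0 < x ^ 2 + x * y + y ^ 2 :=
      lt_of_le_of_ne (by linarith [sq_nonneg (x + y), sq_nonneg x, sq_nonneg y]) h0.symm
    rw [div_le_div_iff₀ hden two_pos]
    linarith [mul_nonneg h (add_nonneg (sq_nonneg x) (sq_nonneg y)),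
      mul_nonneg h (sq_nonneg (x - y))]

end Convolution

end StableConvolution

-- The bound on the potential is attained by `p = q = z` in one variable, for all `a, b > 0`, with
-- `φ₁ = 1 / a` and `φ₂ = 1 / b`.
open StableConvolution in
theorem mainTheorem6_general {n : ℕ} {p q : MvPolynomial (Fin n) ℝ}
    (hp_affine : IsMultiaffine p) (hp_stable : IsRealStable p)
    (hq_affine : IsMultiaffine q) (hq_stable : IsRealStable q)
    (hpq : convolution p q ≠ 0) {a b : Fin n → ℝ} (ha : AboveRoots p a) (hb : AboveRoots q b)
    {φ₁ φ₂ : ℝ} (hφ₁ : ∀ i, potential p i a ≤ φ₁) (hφ₂ : ∀ i, potential q i b ≤ φ₂) :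
    AboveRoots (convolution p q) (fun i => a i + b i - 1 / (φ₁ + φ₂)) ∧
      ∀ i, potential (convolution p q) i (fun i => a i + b i - 1 / (φ₁ + φ₂))
        ≤ φ₁ * φ₂ * (φ₁ + φ₂) / (φ₁ ^ 2 + φ₁ * φ₂ + φ₂ ^ 2) := by
  have hpoint : (fun i => a i + b i - 1 / (φ₁ + φ₂)) = (fun i => a i - 1 / (φ₁ + φ₂)) + b :=
    funext fun i => add_sub_right_comm _ _ _
  obtain ⟨habove, hpot⟩ := ha.polarizedConvolution_barrier hb hp_stable hp_affine hq_stable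
    hq_affine (polarizedConvolution_ne_zero hpq) hφ₁ hφ₂
  rw [hpoint]
  refine ⟨habove.convolution_of_polarizedConvolution hp_affine hq_affine, fun i => ?_⟩
  rw [potential_convolution_add hp_affine hq_affine]
  exact hpot i

theorem mainTheorem6 (n : ℕ) (p q : MvPolynomial (Fin n) ℝ)
    (hp_affine : StableConvolution.IsMultiaffine p)
    (hp_stable : StableConvolution.IsRealStable p)
    (hq_affine : StableConvolution.IsMultiaffine q)
    (hq_stable : StableConvolution.IsRealStable q)
    (hpq : StableConvolution.convolution p q ≠ 0)
    (a b : Fin n → ℝ)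
    (ha : StableConvolution.AboveRoots p a)
    (hb : StableConvolution.AboveRoots q b)
    (φ₁ φ₂ : ℝ)
    (hφ₁ : ∀ i, StableConvolution.potential p i a ≤ φ₁)
    (hφ₂ : ∀ i, StableConvolution.potential q i b ≤ φ₂)
    (c : Fin n → ℝ)
    (hc : ∀ i, c i = a i + b i - 1 / (φ₁ + φ₂)) :
    StableConvolution.AboveRoots (StableConvolution.convolution p q) c ∧
      ∀ i, StableConvolution.potential (StableConvolution.convolution p q) i c
        ≤ (φ₁ + φ₂) / 2 := by
  obtain rfl : c = _ := funext hc
  refine (mainTheorem6_general hp_affine hp_stable hq_affine hq_stable hpq ha hb hφ₁ hφ₂).imp_right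
    fun h i => (h i).trans (StableConvolution.mul_mul_add_div_le_half_add ?_)
  exact add_nonneg ((ha.potential_nonneg hp_affine i).trans (hφ₁ i))
    ((hb.potential_nonneg hq_affine i).trans (hφ₂ i))
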